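/- **Theorem.** Let $(\mathcal C,f)$ be a spin modular category: $\mathcal C$ is a unitary modular category over $\mathbb C$ (a unitary ribbon fusion category, with quantum trace $\operatorname{tr}$ satisfying $\operatorname{tr}(g^\dagger g)>0$ for all morphisms $g\neq 0$, whose $S$-matrix is invertible) with braiding $c$ and twist $\theta$, and $f$ is a fermion, i.e. a simple object with $f\otimes f\cong\mathbf 1$ and $\theta_f=-\mathrm{id}_f$. Let $\Pi$ be the finite set of isomorphism classes (labels) of simple objects $X_i$, with $0$ the label of $\mathbf 1$; put $d_i=\dim X_i$, $D=\big(\sum_{i\in\Pi}d_i^2\big)^{1/2}>0$, $s_{ij}=\frac1D\operatorname{tr}(c_{X_j,X_i}\circ c_{X_i,X_j})$ and $N_{ij}^k=\dim_{\mathbb C}\operatorname{Hom}(X_i\otimes X_j,X_k)$. Let $fi$ denote the label of $f\otimes X_i$. A label $i$ is even if $c_{f,X_i}\circ c_{X_i,f}=\mathrm{id}_{X_i\otimes f}$; let $I_0\subseteq\Pi$ be the set of even labels and $[I_0]$ the set of orbits $[i]=\{i,fi\}$ with $i\in I_0$. For $i,j,k\in I_0$ put $$[s]_{[i],[j]}=2s_{ij},\qquad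 N_{[i][j]}^{[k]}=N_{ij}^k+N_{ij}^{fk}.$$ Then $[s]_{[i],[j]}$ and $N_{[i][j]}^{[k]}$ are well defined (they do not depend on the representatives of the orbits), and: 1. The matrix $[s]=([s]_{a,b})_{a,b\in[I_0]}$ is unitary. 2. $[s]_{[0],r}\neq 0$ for all $r\in[I_0]$, and the Verlinde formula holds: for all $a,b,c\in[I_0]$, $$N_{ab}^{c}=\sum_{r\in[I_0]}\frac{[s]_{a,r}\,[s]_{b,r}\,\overline{[s]_{c,r}}}{[s]_{[0],r}}.$$ -/

import Mathlib

open CategoryTheory CategoryTheory.Limits CategoryTheory.MonoidalCategory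

universe v u

namespace SpinModular

noncomputable section

/-! ### Fusion categories -/

/-- The properties that make a `ℂ`-linear abelian rigid monoidal category with bilinear tensor
product a fusion category over `ℂ`.

Rigidity is supplied by `RightRigidCategory`, where `Xᘁ` comes with `η_ X Xᘁ : 𝟙_ C ⟶ X ⊗ Xᘁ` and
`ε_ X Xᘁ : Xᘁ ⊗ X ⟶ 𝟙_ C`; in a braided category duals on one side are also duals on the other. -/
class IsFusion (C : Type u) [Category.{v} C] [Abelian C] [Linear ℂ C] [MonoidalCategory C]
    [MonoidalPreadditive C] [MonoidalLinear ℂ C] [RightRigidCategory C] : Prop where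
  /-- Hom spaces are finite dimensional. -/
  finiteDimensional_hom : ∀ X Y : C, FiniteDimensional ℂ (X ⟶ Y)
  /-- Every object is a finite direct sum of simple objects. -/
  semisimple : ∀ X : C, ∃ (n : ℕ) (S : Fin n → C) (b : Bicone S),
    (∀ a, Simple (S a)) ∧ Nonempty b.IsBilimit ∧ Nonempty (X ≅ b.pt)
  /-- There are finitely many simple objects up to isomorphism. -/
  finite_simples : ∃ (n : ℕ) (S : Fin n → C), ∀ X : C, Simple X → ∃ a, Nonempty (X ≅ S a)
  /-- The tensor unit is simple. -/
  simple_unit : Simple (𝟙_ C)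

/-- Two simple objects are identified when they are isomorphic. -/
instance simpleSetoid (C : Type u) [Category.{v} C] [HasZeroMorphisms C] :
    Setoid {X : C // Simple X} where
  r X Y := Nonempty (X.1 ≅ Y.1)
  iseqv :=
    { refl := fun X => ⟨Iso.refl X.1⟩
      symm := fun ⟨e⟩ => ⟨e.symm⟩
      trans := fun ⟨e⟩ ⟨e'⟩ => ⟨e.trans e'⟩ }

/-- The label set: isomorphism classes of simple objects. -/
def Label (C : Type u) [Category.{v} C] [HasZeroMorphisms C] : Type u :=
  Quotient (simpleSetoid C)

namespace Label

variable {C : Type u} [Category.{v} C] [HasZeroMorphisms C]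

/-- The label of a simple object. -/
def mk (X : C) (hX : Simple X) : Label C := Quotient.mk (simpleSetoid C) ⟨X, hX⟩

/-- A representative simple object of a label. -/
def obj (i : Label C) : C := (Quotient.out i).1

theorem simple_obj (i : Label C) : Simple i.obj := (Quotient.out i).2

theorem mk_obj (i : Label C) : mk i.obj i.simple_obj = i := Quotient.out_eq i

theorem mk_eq_mk {X Y : C} {hX : Simple X} {hY : Simple Y} :
    mk X hX = mk Y hY ↔ Nonempty (X ≅ Y) := Quotient.eq

end Label

section Fusion

variable (C : Type u) [Category.{v} C] [Abelian C] [Linear ℂ C] [MonoidalCategory C]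
  [MonoidalPreadditive C] [MonoidalLinear ℂ C] [RightRigidCategory C] [IsFusion C]

instance finite_label : Finite (Label C) := by
  obtain ⟨n, S, hS⟩ := IsFusion.finite_simples (C := C)
  choose g hg using fun i : Label C => hS i.obj i.simple_obj
  refine Finite.of_injective g fun i j hij => ?_
  obtain ⟨e⟩ := hg i
  obtain ⟨e'⟩ := hg j
  rw [← i.mk_obj, ← j.mk_obj, Label.mk_eq_mk]
  exact ⟨e.trans ((eqToIso (by rw [hij])).trans e'.symm)⟩

instance fintype_label : Fintype (Label C) := Fintype.ofFinite _

instance decidableEq_label : DecidableEq (Label C) := Classical.decEq _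

/-- The label `0` of the tensor unit. -/
def unitLabel : Label C := Label.mk (𝟙_ C) IsFusion.simple_unit

variable {C}

theorem exists_scalar (g : 𝟙_ C ⟶ 𝟙_ C) : ∃ c : ℂ, c • 𝟙 (𝟙_ C) = g := by
  have := IsFusion.simple_unit (C := C)
  have := IsFusion.finiteDimensional_hom (𝟙_ C) (𝟙_ C)
  exact endomorphism_simple_eq_smul_id ℂ g

/-- The complex number `c` with `g = c • 𝟙`, for an endomorphism `g` of the tensor unit. -/
def scalar (g : 𝟙_ C ⟶ 𝟙_ C) : ℂ := Classical.choose (exists_scalar g)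

theorem scalar_smul (g : 𝟙_ C ⟶ 𝟙_ C) : scalar g • 𝟙 (𝟙_ C) = g :=
  Classical.choose_spec (exists_scalar g)

/-- The fusion coefficients `N_{ij}^k = dim Hom(X_i ⊗ X_j, X_k)`. -/
def fusionCoeff (i j k : Label C) : ℕ := Module.finrank ℂ (i.obj ⊗ j.obj ⟶ k.obj)

end Fusion

/-! ### Ribbon structures and the quantum trace -/

/-- A ribbon structure (twist) on a braided rigid category. -/
class Ribbon (C : Type u) [Category.{v} C] [MonoidalCategory C] [BraidedCategory C]
    [RightRigidCategory C] where
  /-- The twist `θ_X`. -/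
  twist : ∀ X : C, X ≅ X
  twist_naturality : ∀ {X Y : C} (g : X ⟶ Y), g ≫ (twist Y).hom = (twist X).hom ≫ g
  /-- `θ_{X ⊗ Y} = c_{Y,X} ∘ c_{X,Y} ∘ (θ_X ⊗ θ_Y)`. -/
  twist_tensor : ∀ X Y : C, (twist (X ⊗ Y)).hom =
    ((twist X).hom ⊗ₘ (twist Y).hom) ≫ (β_ X Y).hom ≫ (β_ Y X).hom
  /-- `θ_{X*} = (θ_X)*`. -/
  twist_dual : ∀ X : C, (twist (Xᘁ)).hom = ((twist X).hom)ᘁ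

section Trace

variable {C : Type u} [Category.{v} C] [Abelian C] [Linear ℂ C] [MonoidalCategory C]
  [MonoidalPreadditive C] [MonoidalLinear ℂ C] [BraidedCategory C] [RightRigidCategory C]
  [IsFusion C] [Ribbon C]

/-- The quantum trace of an endomorphism `g` of `X`: the scalar
`ev_X ∘ c_{X,X*} ∘ ((θ_X ∘ g) ⊗ id) ∘ coev_X`. -/
def qtrace {X : C} (g : X ⟶ X) : ℂ :=
  scalar (η_ X (Xᘁ) ≫ (g ≫ (Ribbon.twist X).hom) ▷ (Xᘁ) ≫ (β_ X (Xᘁ)).hom ≫ ε_ X (Xᘁ))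

/-- The quantum dimension of an object. -/
def qdim (X : C) : ℂ := qtrace (𝟙 X)

variable (C)

/-- The unnormalized `S`-matrix, `s̃_{ij} = tr(c_{X_j,X_i} ∘ c_{X_i,X_j})`. -/
def unnormalizedS : Matrix (Label C) (Label C) ℂ :=
  fun i j => qtrace ((β_ i.obj j.obj).hom ≫ (β_ j.obj i.obj).hom)

/-- `D`, the nonnegative square root of `D² = ∑_i d_i²`
(in a unitary category all the `d_i` are real). -/
def totalDim : ℝ := Real.sqrt (∑ i : Label C, qdim i.obj ^ 2).re

/-- The normalized `S`-matrix `s = s̃ / D`. -/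
def normalizedS : Matrix (Label C) (Label C) ℂ :=
  fun i j => unnormalizedS C i j / (totalDim C : ℂ)

/-- A ribbon fusion category is modular when its `S`-matrix is invertible. -/
def IsModular : Prop := IsUnit (unnormalizedS C).det

/-- A unitary structure on a ribbon fusion category over `ℂ`: a conjugate-linear involutive
contravariant operation `g ↦ g†`, identical on objects, which respects the tensor product, for
which the associators, unitors, braidings and twists are unitary, and such that the quantum trace
is positive, `tr(g† ∘ g) > 0` for every morphism `g ≠ 0`. (The last condition makes `†` a positive
`*`-structure and says that quantum dimensions of nonzero objects are positive.) -/
class Unitary where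
  /-- The adjoint `g†`. -/
  dagger : ∀ {X Y : C}, (X ⟶ Y) → (Y ⟶ X)
  dagger_dagger : ∀ {X Y : C} (g : X ⟶ Y), dagger (dagger g) = g
  dagger_id : ∀ X : C, dagger (𝟙 X) = 𝟙 X
  dagger_comp : ∀ {X Y Z : C} (g : X ⟶ Y) (h : Y ⟶ Z), dagger (g ≫ h) = dagger h ≫ dagger g
  dagger_add : ∀ {X Y : C} (g h : X ⟶ Y), dagger (g + h) = dagger g + dagger h
  dagger_smul : ∀ {X Y : C} (c : ℂ) (g : X ⟶ Y),
    dagger (c • g) = (starRingEnd ℂ c) • dagger g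
  dagger_tensor : ∀ {X Y X' Y' : C} (g : X ⟶ Y) (h : X' ⟶ Y'),
    dagger (g ⊗ₘ h) = dagger g ⊗ₘ dagger h
  dagger_associator : ∀ X Y Z : C, dagger (α_ X Y Z).hom = (α_ X Y Z).inv
  dagger_leftUnitor : ∀ X : C, dagger (λ_ X).hom = (λ_ X).inv
  dagger_rightUnitor : ∀ X : C, dagger (ρ_ X).hom = (ρ_ X).inv
  dagger_braiding : ∀ X Y : C, dagger (β_ X Y).hom = (β_ X Y).inv
  dagger_twist : ∀ X : C, dagger (Ribbon.twist X).hom = (Ribbon.twist X).inv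
  qtrace_pos : ∀ {X Y : C} (g : X ⟶ Y), g ≠ 0 →
    0 < (qtrace (g ≫ dagger g)).re ∧ (qtrace (g ≫ dagger g)).im = 0

end Trace

/-! ### Fermions -/

/-- A fermion: a simple object `f` with `f ⊗ f ≅ 𝟙` and `θ_f = -1`. -/
structure IsFermion {C : Type u} [Category.{v} C] [Preadditive C] [MonoidalCategory C]
    [BraidedCategory C] [RightRigidCategory C] [Ribbon C] (F : C) : Prop where
  simple : Simple F
  tensor_self : Nonempty (F ⊗ F ≅ 𝟙_ C)
  twist_eq : (Ribbon.twist F).hom = -𝟙 F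

section Fermion

variable {C : Type u} [Category.{v} C] [Abelian C] [MonoidalCategory C]
  [BraidedCategory C] [RightRigidCategory C] [Ribbon C] {F : C}

/-- `F ⊗ (F ⊗ X) ≅ X`, naturally in `X`. -/
def cancelIso (e : F ⊗ F ≅ 𝟙_ C) : tensorLeft F ⋙ tensorLeft F ≅ 𝟭 C :=
  NatIso.ofComponents (fun X => (α_ F F X).symm ≪≫ whiskerRightIso e X ≪≫ λ_ X)
    (fun {X Y} g => by
      change F ◁ F ◁ g ≫ (α_ F F Y).inv ≫ e.hom ▷ Y ≫ (λ_ Y).hom =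
        ((α_ F F X).inv ≫ e.hom ▷ X ≫ (λ_ X).hom) ≫ g
      rw [Category.assoc, Category.assoc, ← leftUnitor_naturality, ← whisker_exchange_assoc,
        associator_inv_naturality_right_assoc])

theorem IsFermion.simple_tensor (hF : IsFermion F) {X : C} (hX : Simple X) : Simple (F ⊗ X) := by
  obtain ⟨e⟩ := hF.tensor_self
  let E : C ≌ C := CategoryTheory.Equivalence.mk (tensorLeft F) (tensorLeft F)
    (cancelIso e).symm (cancelIso e)
  have hE : (tensorLeft F).IsEquivalence := inferInstanceAs E.functor.IsEquivalence
  have : Simple ((𝟭 C).obj X) := hX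
  have : Simple ((tensorLeft F).obj (F ⊗ X)) := Simple.of_iso ((cancelIso e).app X)
  exact (tensorLeft F).simple_of_simple_obj (F ⊗ X)

/-- The action `i ↦ f i` of a fermion on labels, induced by `X ↦ f ⊗ X`. -/
def act (hF : IsFermion F) : Label C → Label C :=
  Quotient.map (fun X => ⟨F ⊗ X.1, hF.simple_tensor X.2⟩)
    (fun _ _ ⟨e⟩ => ⟨whiskerLeftIso F e⟩)

theorem act_act (hF : IsFermion F) (i : Label C) : act hF (act hF i) = i := by
  obtain ⟨e⟩ := hF.tensor_self
  induction i using Quotient.inductionOn with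
  | h X => exact Quotient.sound ⟨(cancelIso e).app X.1⟩

/-- The label `i` lies in the trivial (even) sector: `c_{f,i} ∘ c_{i,f} = id`. (For simple `X_i`
this double braiding is a sign `ε_i` times the identity.) -/
def IsEven (F : C) (i : Label C) : Prop :=
  (β_ i.obj F).hom ≫ (β_ F i.obj).hom = 𝟙 (i.obj ⊗ F)

/-- The set `I₀` of even labels. -/
def EvenLabel (F : C) : Type u := {i : Label C // IsEven F i}

/-- The orbit relation of the fermion action on even labels. -/
def orbitSetoid (hF : IsFermion F) : Setoid (EvenLabel F) where
  r i j := j.1 = i.1 ∨ j.1 = act hF i.1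
  iseqv :=
    { refl := fun i => Or.inl rfl
      symm := fun {i j} h => h.imp Eq.symm fun h => by rw [h, act_act]
      trans := fun {i j k} h h' => by
        rcases h with h | h <;> rcases h' with h' | h' <;> rw [h', h]
        · exact Or.inl rfl
        · exact Or.inr rfl
        · exact Or.inr rfl
        · exact Or.inl (act_act hF i.1) }

/-- `[I₀]`, the set of orbits of even labels. -/
def EvenOrbit (hF : IsFermion F) : Type u := Quotient (orbitSetoid hF)

/-- The orbit `[i]` of an even label. -/
def EvenLabel.orbit (hF : IsFermion F) (i : EvenLabel F) : EvenOrbit hF :=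
  Quotient.mk (orbitSetoid hF) i

/-- An even label covering an orbit. -/
def EvenOrbit.rep {hF : IsFermion F} (a : EvenOrbit hF) : Label C := (Quotient.out a).1

instance decidableEq_evenOrbit (hF : IsFermion F) : DecidableEq (EvenOrbit hF) :=
  Classical.decEq _

variable [Linear ℂ C] [MonoidalPreadditive C] [MonoidalLinear ℂ C] [IsFusion C]

instance fintype_evenOrbit (hF : IsFermion F) : Fintype (EvenOrbit hF) :=
  have : Finite (EvenLabel F) := inferInstanceAs (Finite {i : Label C // IsEven F i})
  have : Finite (EvenOrbit hF) := inferInstanceAs (Finite (Quotient (orbitSetoid hF)))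
  Fintype.ofFinite _

theorem isEven_unitLabel (F : C) : IsEven F (unitLabel C) := by
  obtain ⟨e⟩ : Nonempty ((unitLabel C).obj ≅ 𝟙_ C) :=
    Label.mk_eq_mk.1 (Label.mk_obj (unitLabel C))
  have h : (β_ (𝟙_ C) F).hom ≫ (β_ F (𝟙_ C)).hom = 𝟙 (𝟙_ C ⊗ F) := by simp
  unfold IsEven
  rw [← cancel_mono (e.hom ▷ F), Category.assoc, ← BraidedCategory.braiding_naturality_right,
    ← BraidedCategory.braiding_naturality_left_assoc, h, Category.comp_id, Category.id_comp]

/-- The label `0` as an even label. -/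
def evenUnit (F : C) : EvenLabel F := ⟨unitLabel C, isEven_unitLabel F⟩

/-- The matrix `[s]` indexed by `[I₀]`, `[s]_{[i],[j]} = 2 s_{ij}`. -/
def quotientS (hF : IsFermion F) : Matrix (EvenOrbit hF) (EvenOrbit hF) ℂ :=
  fun a b => 2 * normalizedS C a.rep b.rep

/-- The naive fusion rules `N_{[i][j]}^{[k]} = N_{ij}^k + N_{ij}^{fk}`. -/
def naiveFusion (hF : IsFermion F) (a b c : EvenOrbit hF) : ℕ :=
  fusionCoeff a.rep b.rep c.rep + fusionCoeff a.rep b.rep (act hF c.rep)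

end Fermion

end

end SpinModular

/-! Encircling a simple strand `X` by a loop coloured `Y` gives a scalar, multiplicative and
additive in `Y` (`hopf_tensor`, `hopf_eq_sum`). So each row of the `S`-matrix, divided by its
dimension, is a character of the fusion rules, and the row is a common eigenvector of the fusion
matrices. Fusion with a dual is the transposed matrix; comparing eigenvalues in the Hermitian inner
product shows that the values on duals are complex conjugates and, as `S` is invertible, that
distinct rows are orthogonal. Orthogonality and the Verlinde formula for the whole category follow
by linear algebra (`PairingData`).

The fermion acts through a sign: `S` at `(i, fj)` is `charge F i` times `S` at `(i, j)`, and `i` is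
even exactly when the sign is `1`. Thus `(1 + charge) / 2` is the indicator of the even labels, and
inserting `charge` in a sum amounts to replacing a label by its `f`-translate. Sums over even labels
therefore come from the full formulas at `k` and `fk` (`sum_even_orthogonality`,
`fusionCoeff_add_act`). Since `θ_f = -1` makes the action free on even labels, each orbit has two
elements, which accounts for the factor `2` in `[s]`. -/

namespace SpinModular

open BraidedCategory ExactPairing
open scoped ComplexConjugate

noncomputable section

/-! ### Braid identities behind the trace of a tensor product. -/

section Braided

variable {C : Type u} [Category.{v} C] [MonoidalCategory C] [BraidedCategory C]

/-- Hexagon and naturality along `e`: the strand `X` slides off a cup that closes to the unit. -/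
theorem braiding_whiskerRight_of_unit (X Y Y' : C) (e : Y ⊗ Y' ⟶ 𝟙_ C) :
    (β_ X Y).hom ▷ Y' ⊗≫ Y ◁ (β_ X Y').hom ⊗≫ e ▷ X = 𝟙 _ ⊗≫ X ◁ e ⊗≫ 𝟙 _ := by
  calc
    _ = 𝟙 _ ⊗≫ ((β_ X (Y ⊗ Y')).hom ≫ e ▷ X) ⊗≫ 𝟙 _ := by
      rw [braiding_tensor_right_hom]; monoidal
    _ = _ := by
      rw [← braiding_naturality_right, braiding_tensorUnit_right]; monoidal

/-- After Yang–Baxter, the strand `Y` slides off the closure of `X`, and then `X` off that of `Y`.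
Each slide uses up one crossing of the double braiding that `twist_tensor` produces. -/
theorem twice_braiding_whiskerRight_evaluation (X X' Y Y' : C) (e : X' ⊗ X ⟶ 𝟙_ C)
    (e' : Y' ⊗ Y ⟶ 𝟙_ C) :
    ((β_ X Y).hom ≫ (β_ Y X).hom) ▷ (Y' ⊗ X') ≫ (β_ (X ⊗ Y) (Y' ⊗ X')).hom ⊗≫
        Y' ◁ e ▷ Y ⊗≫ e' =
      𝟙 _ ⊗≫ X ◁ ((β_ Y Y').hom ≫ e') ▷ X' ⊗≫ (β_ X X').hom ≫ e := by
  calc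
    _ = 𝟙 _ ⊗≫ ((β_ X Y).hom ≫ (β_ Y X).hom) ▷ Y' ▷ X' ⊗≫ X ◁ (β_ Y Y').hom ▷ X' ⊗≫
        ((X ⊗ Y') ◁ (β_ Y X').hom ≫ (β_ X Y').hom ▷ (X' ⊗ Y)) ⊗≫
        Y' ◁ ((β_ X X').hom ≫ e) ▷ Y ⊗≫ e' := by
      rw [braiding_tensor_left_hom, braiding_tensor_right_hom, braiding_tensor_right_hom]
      monoidal
    _ = 𝟙 _ ⊗≫ (β_ X Y).hom ▷ Y' ▷ X' ⊗≫
        ((β_ Y X).hom ▷ Y' ⊗≫ X ◁ (β_ Y Y').hom ⊗≫ (β_ X Y').hom ▷ Y) ▷ X' ⊗≫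
        (Y' ⊗ X) ◁ (β_ Y X').hom ⊗≫ Y' ◁ ((β_ X X').hom ≫ e) ▷ Y ⊗≫ e' := by
      rw [whisker_exchange]
      monoidal
    _ = 𝟙 _ ⊗≫ ((β_ X Y).hom ▷ Y' ⊗≫ Y ◁ (β_ X Y').hom) ▷ X' ⊗≫ (β_ Y Y').hom ▷ X ▷ X' ⊗≫
        Y' ◁ ((β_ Y X).hom ▷ X' ⊗≫ X ◁ (β_ Y X').hom ⊗≫ ((β_ X X').hom ≫ e) ▷ Y) ⊗≫ e' := by
      rw [yang_baxter']
      monoidal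
    _ = 𝟙 _ ⊗≫ ((β_ X Y).hom ▷ Y' ⊗≫ Y ◁ (β_ X Y').hom) ▷ X' ⊗≫
        ((β_ Y Y').hom ▷ (X ⊗ X') ≫ (Y' ⊗ Y) ◁ ((β_ X X').hom ≫ e)) ⊗≫ e' ▷ 𝟙_ C ⊗≫ 𝟙 _ := by
      rw [braiding_whiskerRight_of_unit]
      monoidal
    _ = 𝟙 _ ⊗≫ ((β_ X Y).hom ▷ Y' ⊗≫ Y ◁ (β_ X Y').hom) ▷ X' ⊗≫
        (Y ⊗ Y') ◁ ((β_ X X').hom ≫ e) ⊗≫ (((β_ Y Y').hom ≫ e') ▷ 𝟙_ C) ⊗≫ 𝟙 _ := by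
      rw [← whisker_exchange]
      monoidal
    _ = 𝟙 _ ⊗≫ ((β_ X Y).hom ▷ Y' ⊗≫ Y ◁ (β_ X Y').hom) ▷ X' ⊗≫
        ((Y ⊗ Y') ◁ ((β_ X X').hom ≫ e) ≫ ((β_ Y Y').hom ≫ e') ▷ 𝟙_ C) ⊗≫ 𝟙 _ := by
      monoidal
    _ = 𝟙 _ ⊗≫ ((β_ X Y).hom ▷ Y' ⊗≫ Y ◁ (β_ X Y').hom ⊗≫
        ((β_ Y Y').hom ≫ e') ▷ X) ▷ X' ⊗≫ (β_ X X').hom ≫ e := by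
      rw [whisker_exchange]
      monoidal
    _ = _ := by
      rw [braiding_whiskerRight_of_unit]
      monoidal

end Braided

/-! ### Traces and partial traces relative to arbitrary exact pairings. -/

section Ribbon

variable {C : Type u} [Category.{v} C] [MonoidalCategory C] [BraidedCategory C]
  [RightRigidCategory C] [Ribbon C]

/-- The twisted evaluation `X ⊗ X' ⟶ 𝟙` attached to an exact pairing of `X` with `X'`. -/
def cap (X X' : C) [ExactPairing X X'] : X ⊗ X' ⟶ 𝟙_ C :=
  (Ribbon.twist X).hom ▷ X' ≫ (β_ X X').hom ≫ ε_ X X'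

/-- The trace of an endomorphism of `X`, computed with an exact pairing of `X` with `X'`. -/
def loop {X : C} (X' : C) [ExactPairing X X'] (g : X ⟶ X) : 𝟙_ C ⟶ 𝟙_ C :=
  η_ X X' ≫ g ▷ X' ≫ cap X X'

/-- The trace of a composite does not depend on the order, nor on the exact pairings used. -/
theorem loop_comp_comm {X Y : C} (X' Y' : C) [ExactPairing X X'] [ExactPairing Y Y']
    (g : X ⟶ Y) (h : Y ⟶ X) : loop X' (g ≫ h) = loop Y' (h ≫ g) := by
  -- With `X'` and `Y'` declared to be the duals, `m` is the mate of `h`, which carries `h` around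
  -- the loop.
  let _ : HasRightDual X := ⟨X'⟩
  let _ : HasRightDual Y := ⟨Y'⟩
  obtain ⟨m, h₁, h₂⟩ : ∃ m : X' ⟶ Y', η_ X X' ≫ X ◁ m = η_ Y Y' ≫ h ▷ Y' ∧
      m ▷ Y ≫ ε_ Y Y' = X' ◁ h ≫ ε_ X X' :=
    ⟨hᘁ, coevaluation_comp_rightAdjointMate h, rightAdjointMate_comp_evaluation h⟩
  calc
    _ = η_ X X' ≫ (g ≫ h ≫ (Ribbon.twist X).hom) ▷ X' ≫ (β_ X X').hom ≫ ε_ X X' := by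
      simp [loop, cap]
    _ = η_ X X' ≫ (g ≫ (Ribbon.twist Y).hom) ▷ X' ≫ (β_ Y X').hom ≫ X' ◁ h ≫ ε_ X X' := by
      rw [Ribbon.twist_naturality]; simp
    _ = η_ X X' ≫ (g ≫ (Ribbon.twist Y).hom) ▷ X' ≫ Y ◁ m ≫ (β_ Y Y').hom ≫ ε_ Y Y' := by
      rw [← h₂, braiding_naturality_right_assoc]
    _ = (η_ X X' ≫ X ◁ m) ≫ (g ≫ (Ribbon.twist Y).hom) ▷ Y' ≫ (β_ Y Y').hom ≫ ε_ Y Y' := by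
      rw [← whisker_exchange_assoc, Category.assoc]
    _ = _ := by
      rw [h₁]; simp [loop, cap]

/-- The twisted evaluation is compatible with tensor products. -/
theorem cap_tensor (X X' Y Y' : C) [ExactPairing X X'] [ExactPairing Y Y'] :
    cap (X ⊗ Y) (Y' ⊗ X') = 𝟙 _ ⊗≫ X ◁ cap Y Y' ▷ X' ⊗≫ cap X X' := by
  calc
    _ = ((Ribbon.twist X).hom ▷ Y ≫ X ◁ (Ribbon.twist Y).hom) ▷ (Y' ⊗ X') ≫
        (((β_ X Y).hom ≫ (β_ Y X).hom) ▷ (Y' ⊗ X') ≫ (β_ (X ⊗ Y) (Y' ⊗ X')).hom ⊗≫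
        Y' ◁ ε_ X X' ▷ Y ⊗≫ ε_ Y Y') := by
      rw [cap, Ribbon.twist_tensor, tensor_evaluation, MonoidalCategory.tensorHom_def]
      monoidal
    _ = 𝟙 _ ⊗≫ ((Ribbon.twist X).hom ▷ ((Y ⊗ Y') ⊗ X') ≫ X ◁ (cap Y Y' ▷ X')) ⊗≫
        (β_ X X').hom ≫ ε_ X X' := by
      rw [twice_braiding_whiskerRight_evaluation, cap]
      monoidal
    _ = _ := by
      rw [← whisker_exchange]
      simp only [cap]
      monoidal

/-- The partial trace over the second tensor factor. -/
def partialTrace {X Z Y : C} (Y' : C) [ExactPairing Y Y'] (g : X ⊗ Y ⟶ Z ⊗ Y) : X ⟶ Z :=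
  𝟙 _ ⊗≫ X ◁ η_ Y Y' ⊗≫ g ▷ Y' ⊗≫ Z ◁ cap Y Y' ⊗≫ 𝟙 _

/-- By `cap_tensor`, closing `X ⊗ Y` means closing `Y` and then `X`. -/
theorem loop_partialTrace {X Y : C} (X' Y' : C) [ExactPairing X X'] [ExactPairing Y Y']
    (g : X ⊗ Y ⟶ X ⊗ Y) : loop X' (partialTrace Y' g) = loop (Y' ⊗ X') g := by
  rw [loop, loop, cap_tensor, tensor_coevaluation, partialTrace]
  monoidal

theorem partialTrace_comp_whiskerRight {X Z W Y : C} (Y' : C) [ExactPairing Y Y']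
    (g : X ⊗ Y ⟶ Z ⊗ Y) (b : Z ⟶ W) :
    partialTrace Y' (g ≫ b ▷ Y) = partialTrace Y' g ≫ b := by
  calc
    _ = 𝟙 _ ⊗≫ X ◁ η_ Y Y' ⊗≫ g ▷ Y' ⊗≫ (b ▷ (Y ⊗ Y') ≫ W ◁ cap Y Y') ⊗≫ 𝟙 _ := by
      rw [partialTrace]; monoidal
    _ = _ := by rw [← whisker_exchange, partialTrace]; monoidal

theorem partialTrace_whiskerRight_comp {X Z W Y : C} (Y' : C) [ExactPairing Y Y']
    (a : X ⟶ Z) (g : Z ⊗ Y ⟶ W ⊗ Y) :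
    partialTrace Y' (a ▷ Y ≫ g) = a ≫ partialTrace Y' g := by
  calc
    _ = 𝟙 _ ⊗≫ (X ◁ η_ Y Y' ≫ a ▷ (Y ⊗ Y')) ⊗≫ g ▷ Y' ⊗≫ W ◁ cap Y Y' ⊗≫ 𝟙 _ := by
      rw [partialTrace]; monoidal
    _ = _ := by rw [whisker_exchange, partialTrace]; monoidal

theorem partialTrace_whiskerLeft {X Y : C} (W Y' : C) [ExactPairing Y Y']
    (g : X ⊗ Y ⟶ X ⊗ Y) :
    partialTrace Y' (𝟙 _ ⊗≫ W ◁ g ⊗≫ 𝟙 _ : (W ⊗ X) ⊗ Y ⟶ (W ⊗ X) ⊗ Y) =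
      W ◁ partialTrace Y' g := by
  rw [partialTrace, partialTrace]
  monoidal

end Ribbon

/-! ### Double braidings. -/

section Ribbon

variable {C : Type u} [Category.{v} C] [MonoidalCategory C] [BraidedCategory C]

/-- The double braiding of `X` with `Y`. -/
def monodromy (X Y : C) : X ⊗ Y ⟶ X ⊗ Y := (β_ X Y).hom ≫ (β_ Y X).hom

theorem monodromy_naturality_right (X : C) {Y Z : C} (g : Y ⟶ Z) :
    X ◁ g ≫ monodromy X Z = monodromy X Y ≫ X ◁ g := by
  simp [monodromy]

theorem monodromy_unit_left (X : C) : monodromy (𝟙_ C) X = 𝟙 _ := by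
  simp [monodromy]

/-- Isolates the loop of `X` with `Z`, so that a partial trace over `Z` passes the outer braidings.
-/
theorem monodromy_tensor_right (X Y Z : C) :
    (α_ X Y Z).hom ≫ monodromy X (Y ⊗ Z) ≫ (α_ X Y Z).inv =
      (β_ X Y).hom ▷ Z ≫ (𝟙 _ ⊗≫ Y ◁ monodromy X Z ⊗≫ 𝟙 _ : (Y ⊗ X) ⊗ Z ⟶ (Y ⊗ X) ⊗ Z) ≫
        (β_ Y X).hom ▷ Z := by
  simp only [monodromy, braiding_tensor_left_hom, braiding_tensor_right_hom]
  monoidal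

variable [RightRigidCategory C] [Ribbon C]

/-- Under `𝟙 ⊗ 𝟙 ≅ 𝟙` the twist axiom says that this invertible map is idempotent. -/
theorem twist_unit : (Ribbon.twist (𝟙_ C)).hom = 𝟙 _ := by
  have h := Ribbon.twist_naturality (λ_ (𝟙_ C)).hom
  rw [Ribbon.twist_tensor] at h
  have h' : (β_ (𝟙_ C) (𝟙_ C)).hom ≫ (β_ (𝟙_ C) (𝟙_ C)).hom = 𝟙 _ := monodromy_unit_left _
  rw [h', Category.comp_id, MonoidalCategory.tensorHom_def, Category.assoc,
    leftUnitor_naturality, unitors_equal, rightUnitor_naturality_assoc, cancel_epi] at h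
  rw [← cancel_epi (Ribbon.twist (𝟙_ C)).hom, ← h, Category.comp_id]

end Ribbon

/-! ### Multiplicities in semisimple objects and Hopf link invariants. -/

section Fusion

variable {C : Type u} [Category.{v} C] [Abelian C] [Linear ℂ C] [MonoidalCategory C]
  [MonoidalPreadditive C] [MonoidalLinear ℂ C] [RightRigidCategory C] [IsFusion C]

theorem scalar_eq {g : 𝟙_ C ⟶ 𝟙_ C} {c : ℂ} (h : g = c • 𝟙 _) : scalar g = c := by
  have := IsFusion.simple_unit (C := C)
  have h' := scalar_smul g
  rw [h] at h'
  exact smul_left_injective ℂ (id_nonzero (𝟙_ C)) (by simpa [h] using h')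

theorem scalar_add (g h : 𝟙_ C ⟶ 𝟙_ C) : scalar (g + h) = scalar g + scalar h :=
  scalar_eq (by rw [add_smul, scalar_smul, scalar_smul])

theorem scalar_smul_hom (c : ℂ) (g : 𝟙_ C ⟶ 𝟙_ C) : scalar (c • g) = c * scalar g :=
  scalar_eq (by rw [mul_smul, scalar_smul])

instance finiteDimensional_hom (X Y : C) : FiniteDimensional ℂ (X ⟶ Y) :=
  IsFusion.finiteDimensional_hom X Y

theorem exists_smul_id {X : C} (hX : Simple X) (g : X ⟶ X) : ∃ c : ℂ, g = c • 𝟙 X :=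
  (endomorphism_simple_eq_smul_id ℂ g).imp fun _ => Eq.symm

/-- Every object is a finite direct sum of the chosen simple objects. -/
theorem exists_decomposition (Y : C) : ∃ (n : ℕ) (l : Fin n → Label C)
    (p : ∀ a, Y ⟶ (l a).obj) (q : ∀ a, (l a).obj ⟶ Y),
    (∀ a, q a ≫ p a = 𝟙 _) ∧ (∀ a b, a ≠ b → q a ≫ p b = 0) ∧ ∑ a, p a ≫ q a = 𝟙 Y := by
  obtain ⟨n, S, b, hS, ⟨hb⟩, ⟨e⟩⟩ := IsFusion.semisimple Y
  have h (a) : Nonempty ((Label.mk (S a) (hS a)).obj ≅ S a) := Label.mk_eq_mk.1 (Label.mk_obj _)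
  let i (a) := (h a).some
  refine ⟨n, fun a => Label.mk (S a) (hS a), fun a => e.hom ≫ b.π a ≫ (i a).inv,
    fun a => (i a).hom ≫ b.ι a ≫ e.inv, fun a => ?_, fun a c hac => ?_, ?_⟩
  · simp
  · simp [bicone_ι_π_ne_assoc b hac]
  · calc
      _ = e.hom ≫ (∑ a, b.π a ≫ b.ι a) ≫ e.inv := by
        simp [Preadditive.comp_sum, Preadditive.sum_comp]
      _ = 𝟙 Y := by rw [IsBilimit.total hb]; simp

theorem finrank_hom_label (i j : Label C) :
    Module.finrank ℂ (i.obj ⟶ j.obj) = if i = j then 1 else 0 := by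
  have := i.simple_obj
  have := j.simple_obj
  classical
  rw [finrank_hom_simple_simple]
  refine if_congr ?_ rfl rfl
  rw [← Label.mk_eq_mk (hX := i.simple_obj) (hY := j.simple_obj), i.mk_obj, j.mk_obj]

/-- Morphisms out of a direct sum of simple objects. -/
def homEquivOfDecomposition {Y : C} {n : ℕ} {m : Fin n → Label C}
    (p : ∀ a, Y ⟶ (m a).obj) (q : ∀ a, (m a).obj ⟶ Y) (hpq : ∀ a, q a ≫ p a = 𝟙 _)
    (hne : ∀ a b, a ≠ b → q a ≫ p b = 0) (hsum : ∑ a, p a ≫ q a = 𝟙 Y) (Z : C) :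
    (Y ⟶ Z) ≃ₗ[ℂ] (∀ a, (m a).obj ⟶ Z) where
  toFun g a := q a ≫ g
  invFun g := ∑ a, p a ≫ g a
  map_add' g h := by ext; simp
  map_smul' c g := by ext; simp
  left_inv g := by
    simp only [← Category.assoc, ← Preadditive.sum_comp, hsum, Category.id_comp]
  right_inv g := by
    ext a
    dsimp only
    rw [Preadditive.comp_sum, Finset.sum_eq_single a]
    · rw [← Category.assoc, hpq, Category.id_comp]
    · intro b _ hb
      rw [← Category.assoc, hne a b hb.symm, zero_comp]
    · simp

/-- Morphisms into a direct sum of simple objects. -/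
def homEquivOfDecomposition' {Y : C} {n : ℕ} {m : Fin n → Label C}
    (p : ∀ a, Y ⟶ (m a).obj) (q : ∀ a, (m a).obj ⟶ Y) (hpq : ∀ a, q a ≫ p a = 𝟙 _)
    (hne : ∀ a b, a ≠ b → q a ≫ p b = 0) (hsum : ∑ a, p a ≫ q a = 𝟙 Y) (Z : C) :
    (Z ⟶ Y) ≃ₗ[ℂ] (∀ a, Z ⟶ (m a).obj) where
  toFun g a := g ≫ p a
  invFun g := ∑ a, g a ≫ q a
  map_add' g h := by ext; simp
  map_smul' c g := by ext; simp
  left_inv g := by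
    simp only [Category.assoc, ← Preadditive.comp_sum, hsum, Category.comp_id]
  right_inv g := by
    ext a
    dsimp only
    rw [Preadditive.sum_comp, Finset.sum_eq_single a]
    · rw [Category.assoc, hpq, Category.comp_id]
    · intro b _ hb
      rw [Category.assoc, hne b a hb, comp_zero]
    · simp

/-- The duality bijection is linear. -/
def tensorLeftHomLinearEquiv (X Y Y' Z : C) [ExactPairing Y Y'] :
    (Y' ⊗ X ⟶ Z) ≃ₗ[ℂ] (X ⟶ Y ⊗ Z) where
  __ := tensorLeftHomEquiv X Y Y' Z
  map_add' g h := by simp [tensorLeftHomEquiv]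
  map_smul' c g := by simp [tensorLeftHomEquiv]

theorem finrank_hom_symm (Y : C) (l : Label C) :
    Module.finrank ℂ (l.obj ⟶ Y) = Module.finrank ℂ (Y ⟶ l.obj) := by
  obtain ⟨n, m, p, q, hpq, hne, hsum⟩ := exists_decomposition Y
  rw [(homEquivOfDecomposition p q hpq hne hsum l.obj).finrank_eq,
    (homEquivOfDecomposition' p q hpq hne hsum l.obj).finrank_eq]
  simp [Module.finrank_pi_fintype, finrank_hom_label, eq_comm]

/-- The number of simple summands with a given label. -/
theorem card_decomposition {Y : C} {n : ℕ} {m : Fin n → Label C}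
    (p : ∀ a, Y ⟶ (m a).obj) (q : ∀ a, (m a).obj ⟶ Y) (hpq : ∀ a, q a ≫ p a = 𝟙 _)
    (hne : ∀ a b, a ≠ b → q a ≫ p b = 0) (hsum : ∑ a, p a ≫ q a = 𝟙 Y) (l : Label C) :
    Module.finrank ℂ (Y ⟶ l.obj) = ∑ a, if m a = l then 1 else 0 := by
  rw [(homEquivOfDecomposition p q hpq hne hsum l.obj).finrank_eq]
  simp [Module.finrank_pi_fintype, finrank_hom_label]

/-- Duality followed by semisimplicity. This is what makes fusion with a dual the transpose of
fusion with the object. -/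
theorem finrank_tensor_label_symm (X : C) (k l : Label C) :
    Module.finrank ℂ (Xᘁ ⊗ k.obj ⟶ l.obj) = Module.finrank ℂ (X ⊗ l.obj ⟶ k.obj) := by
  rw [← finrank_hom_symm (X ⊗ l.obj) k]
  exact (tensorLeftHomLinearEquiv k.obj X Xᘁ l.obj).finrank_eq

variable [BraidedCategory C] [Ribbon C]

/-- Allows `Yᘁ ⊗ Xᘁ` to serve as the dual of `X ⊗ Y` in place of the chosen one. -/
theorem qtrace_eq_scalar_loop {X : C} (X' : C) [ExactPairing X X'] (g : X ⟶ X) :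
    qtrace g = scalar (loop X' g) := by
  have h : qtrace g = scalar (loop Xᘁ g) := by simp [qtrace, loop, cap]
  have h' := loop_comp_comm Xᘁ X' g (𝟙 X)
  rw [Category.comp_id, Category.id_comp] at h'
  rw [h, h']

theorem qtrace_comp_comm {X Y : C} (g : X ⟶ Y) (h : Y ⟶ X) : qtrace (g ≫ h) = qtrace (h ≫ g) := by
  rw [qtrace_eq_scalar_loop Xᘁ, qtrace_eq_scalar_loop Yᘁ, loop_comp_comm Xᘁ Yᘁ]

variable (C) in
/-- The quantum trace as a linear functional. -/
def qtraceLinear (X : C) : (X ⟶ X) →ₗ[ℂ] ℂ where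
  toFun := qtrace
  map_add' g h := by simp [qtrace_eq_scalar_loop Xᘁ, loop, scalar_add]
  map_smul' c g := by simp [qtrace_eq_scalar_loop Xᘁ, loop, scalar_smul_hom]

theorem qtrace_smul {X : C} (c : ℂ) (g : X ⟶ X) : qtrace (c • g) = c * qtrace g :=
  (qtraceLinear C X).map_smul c g

theorem qtrace_sum {X : C} {ι : Type*} (s : Finset ι) (g : ι → (X ⟶ X)) :
    qtrace (∑ a ∈ s, g a) = ∑ a ∈ s, qtrace (g a) :=
  map_sum (qtraceLinear C X) g s

theorem qtrace_partialTrace {X Y : C} (g : X ⊗ Y ⟶ X ⊗ Y) :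
    qtrace (partialTrace Yᘁ g) = qtrace g := by
  rw [qtrace_eq_scalar_loop Xᘁ, qtrace_eq_scalar_loop (Yᘁ ⊗ Xᘁ), loop_partialTrace]

/-- The invariant of the Hopf link labelled by two objects. -/
def hopf (X Y : C) : ℂ := qtrace (monodromy X Y)

theorem hopf_comm (X Y : C) : hopf X Y = hopf Y X := qtrace_comp_comm _ _

/-- Cyclicity of the trace, with `g` slid through the double braiding by naturality. -/
theorem qtrace_monodromy_comp_whiskerLeft (X : C) {Y Z : C} (g : Y ⟶ Z) (h : Z ⟶ Y) :
    qtrace (monodromy X Y ≫ X ◁ (g ≫ h)) = qtrace (monodromy X Z ≫ X ◁ (h ≫ g)) := by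
  rw [MonoidalCategory.whiskerLeft_comp, ← Category.assoc, qtrace_comp_comm,
    ← Category.assoc, monodromy_naturality_right, Category.assoc,
    MonoidalCategory.whiskerLeft_comp]

theorem hopf_congr_right (X : C) {Y Z : C} (e : Y ≅ Z) : hopf X Y = hopf X Z := by
  simpa [hopf] using qtrace_monodromy_comp_whiskerLeft X e.hom e.inv

theorem hopf_congr_left {X Y : C} (e : X ≅ Y) (Z : C) : hopf X Z = hopf Y Z := by
  rw [hopf_comm, hopf_congr_right Z e, hopf_comm]

theorem hopf_unit_left (X : C) : hopf (𝟙_ C) X = qdim X := by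
  rw [hopf, monodromy_unit_left, qdim, ← (λ_ X).hom_inv_id, qtrace_comp_comm, Iso.inv_hom_id]

/-- The Hopf link pairing with a simple object is, up to normalization, multiplicative. -/
theorem hopf_tensor {X : C} (hX : Simple X) (Y Z : C) :
    hopf X (Y ⊗ Z) * qdim X = hopf X Y * hopf X Z := by
  -- The loop `Z` around the simple strand `X` acts by a scalar `c`, with or without `Y` present.
  obtain ⟨c, hc⟩ := exists_smul_id hX (partialTrace Zᘁ (monodromy X Z))
  have hZ : hopf X Z = c * qdim X := by
    rw [hopf, ← qtrace_partialTrace, hc, qtrace_smul, qdim]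
  have hYZ : hopf X (Y ⊗ Z) = c * hopf X Y := by
    rw [hopf, ← Category.comp_id (monodromy X (Y ⊗ Z)), ← (α_ X Y Z).inv_hom_id,
      ← Category.assoc, ← qtrace_comp_comm, monodromy_tensor_right, ← qtrace_partialTrace,
      partialTrace_whiskerRight_comp, partialTrace_comp_whiskerRight, partialTrace_whiskerLeft, hc]
    simp [qtrace_smul, hopf, monodromy]
  rw [hYZ, hZ]
  ring

/-- The Hopf link pairing is additive. -/
theorem hopf_eq_sum (X Y : C) :
    hopf X Y = ∑ l : Label C, Module.finrank ℂ (Y ⟶ l.obj) * hopf X l.obj := by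
  obtain ⟨n, m, p, q, hpq, hne, hsum⟩ := exists_decomposition Y
  calc
    _ = ∑ a, qtrace (monodromy X Y ≫ X ◁ (p a ≫ q a)) := by
      rw [hopf, ← qtrace_sum, ← Preadditive.comp_sum, ← whiskerLeft_sum, hsum,
        MonoidalCategory.whiskerLeft_id, Category.comp_id]
    _ = ∑ a, hopf X (m a).obj := by
      refine Finset.sum_congr rfl fun a _ => ?_
      rw [qtrace_monodromy_comp_whiskerLeft, hpq, MonoidalCategory.whiskerLeft_id,
        Category.comp_id, hopf]
    _ = ∑ l : Label C, ∑ a, if m a = l then hopf X l.obj else 0 := by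
      rw [Finset.sum_comm]
      simp
    _ = _ := by
      refine Finset.sum_congr rfl fun l _ => ?_
      rw [card_decomposition p q hpq hne hsum]
      simp [Finset.sum_ite]

theorem qdim_pos [Unitary C] {X : C} (hX : Simple X) : 0 < (qdim X).re ∧ (qdim X).im = 0 := by
  have h := Unitary.qtrace_pos (𝟙 X) (id_nonzero X)
  rwa [Unitary.dagger_id, Category.comp_id] at h

end Fusion

/-! ### Linear algebra of characters: orthogonality and the Verlinde formula. -/

section FusionData

variable {I : Type*} [Fintype I] [DecidableEq I]

/-- Numerical fusion data with a pairing `S` whose rows are, up to the factors `d`, characters of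
the fusion rules `N` and of the transposed fusion rules (with values `S'`). -/
structure PairingData (I : Type*) [Fintype I] [DecidableEq I] where
  /-- The pairing. -/
  S : Matrix I I ℂ
  /-- The values of the characters on dual objects. -/
  S' : Matrix I I ℂ
  /-- The dimensions. -/
  d : I → ℂ
  /-- The fusion coefficients. -/
  N : I → I → I → ℕ
  /-- The unit. -/
  unit : I
  conj_d : ∀ i, conj (d i) = d i
  d_ne_zero : ∀ i, d i ≠ 0
  symm : ∀ i j, S i j = S j i
  unit_left : ∀ i, S unit i = d i
  isUnit_det : IsUnit S.det
  fusion : ∀ r j k, S r j * S r k = d r * ∑ l, N j k l * S r l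
  -- The coefficient is `N j l k`, not `N j k l`: the dual acts by the transpose.
  fusion_dual : ∀ r j k, S' r j * S r k = d r * ∑ l, N j l k * S r l
  fusion_unit : ∀ j k, N j unit k = if j = k then 1 else 0

namespace PairingData

variable (P : PairingData I)

/-- The Gram matrix of the rows of the pairing. -/
def gram (q r : I) : ℂ := ∑ k, conj (P.S q k) * P.S r k

theorem gram_self_ne_zero (r : I) : P.gram r r ≠ 0 := by
  have h : P.gram r r = ((∑ k, Complex.normSq (P.S r k) : ℝ) : ℂ) := by
    simp [gram, Complex.normSq_eq_conj_mul_self]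
  rw [h, Complex.ofReal_ne_zero]
  refine (Finset.sum_pos' (fun k _ => Complex.normSq_nonneg _)
    ⟨P.unit, Finset.mem_univ _, ?_⟩).ne'
  rw [Complex.normSq_pos, P.symm, P.unit_left]
  exact P.d_ne_zero r

/-- Row `r` is an eigenvector of fusion by `j` with eigenvalue `S r j / d r`, row `q` one of its
transpose with eigenvalue `S' q j / d q`. Moving the real matrix across the inner product equates
the two, up to a conjugation; denominators are cleared. -/
theorem character_mul_gram (j q r : I) :
    P.d q * P.S r j * P.gram q r = P.d r * conj (P.S' q j) * P.gram q r := by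
  have h₁ : P.S r j * P.gram q r =
      P.d r * ∑ k, ∑ l, conj (P.S q k) * (P.N j k l * P.S r l) := by
    rw [gram, Finset.mul_sum, Finset.mul_sum]
    refine Finset.sum_congr rfl fun k _ => ?_
    rw [← Finset.mul_sum, mul_left_comm, P.fusion, mul_left_comm]
  have h₂ : conj (P.S' q j) * P.gram q r =
      P.d q * ∑ l, ∑ k, conj (P.S q k) * (P.N j k l * P.S r l) := by
    rw [gram, Finset.mul_sum, Finset.mul_sum]
    refine Finset.sum_congr rfl fun l _ => ?_
    rw [← mul_assoc, ← map_mul, P.fusion_dual, map_mul, P.conj_d, map_sum, mul_assoc,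
      Finset.sum_mul]
    congr 1
    refine Finset.sum_congr rfl fun k _ => ?_
    simp only [map_mul, map_natCast]
    ring
  rw [mul_assoc, h₁, mul_assoc, h₂, Finset.sum_comm]
  ring

theorem conj_dual (r j : I) : conj (P.S' r j) = P.S r j :=
  (mul_left_cancel₀ (P.d_ne_zero r)
    (mul_right_cancel₀ (P.gram_self_ne_zero r) (P.character_mul_gram j r r))).symm

/-- A nonzero inner product would force the two characters to agree, hence the rows to be
proportional, against invertibility of `S`. -/
theorem gram_eq_zero {q r : I} (h : q ≠ r) : P.gram q r = 0 := by
  by_contra hg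
  have h' (j) : P.d q * P.S r j = P.d r * P.S q j := by
    rw [← P.conj_dual q]
    exact mul_right_cancel₀ hg (P.character_mul_gram j q r)
  refine P.isUnit_det.ne_zero (Matrix.exists_vecMul_eq_zero_iff.1
    ⟨Pi.single r (P.d q) - Pi.single q (P.d r), fun h0 => ?_, ?_⟩)
  · have := congrFun h0 r
    simp [h.symm, P.d_ne_zero] at this
  · ext j
    simp [Matrix.sub_vecMul, h']

/-- The global dimension. -/
def globalDim : ℂ := ∑ k, P.d k ^ 2

theorem sum_dim_mul (r : I) : ∑ k, P.d k * P.S r k = if r = P.unit then P.globalDim else 0 := by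
  have h : ∑ k, P.d k * P.S r k = P.gram P.unit r := by simp [gram, P.unit_left, P.conj_d]
  split_ifs with hr
  · simp [hr, P.unit_left, globalDim, sq]
  · rw [h, P.gram_eq_zero (Ne.symm hr)]

/-- Beyond `gram_eq_zero` this gives the norm of each row: the dual fusion rule expands the product
into characters, and `sum_dim_mul` keeps only the unit. -/
theorem orthogonality (j k : I) :
    ∑ r, P.S j r * conj (P.S k r) = if j = k then P.globalDim else 0 := by
  have h (r) : P.S j r * conj (P.S k r) = ∑ l, P.N k l j * (P.d r * P.S l r) := by
    have hk : conj (P.S k r) = P.S' r k := by rw [P.symm k, ← P.conj_dual, Complex.conj_conj]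
    rw [hk, mul_comm, P.symm j, P.fusion_dual, Finset.mul_sum]
    refine Finset.sum_congr rfl fun l _ => ?_
    rw [P.symm r]
    ring
  simp_rw [h]
  rw [Finset.sum_comm]
  simp_rw [← Finset.mul_sum, P.sum_dim_mul]
  simp [P.fusion_unit, eq_comm]

/-- The fusion rule expands the product of two entries, and orthogonality extracts the coefficient
of `k`. -/
theorem verlinde (i j k : I) :
    ∑ r, P.S i r * P.S j r * conj (P.S k r) / P.d r = P.N i j k * P.globalDim := by
  have h (r) : P.S i r * P.S j r * conj (P.S k r) / P.d r =
      ∑ l, P.N i j l * (P.S l r * conj (P.S k r)) := by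
    rw [P.symm i, P.symm j, P.fusion, mul_assoc, mul_div_cancel_left₀ _ (P.d_ne_zero r),
      Finset.sum_mul]
    refine Finset.sum_congr rfl fun l _ => ?_
    rw [P.symm r, mul_assoc]
  simp_rw [h]
  rw [Finset.sum_comm]
  simp_rw [← Finset.mul_sum, P.orthogonality]
  simp

theorem globalDim_ne_zero : P.globalDim ≠ 0 := by
  have h : P.globalDim = P.gram P.unit P.unit := by
    simp [globalDim, gram, P.unit_left, P.conj_d, sq]
  rw [h]
  exact P.gram_self_ne_zero _

end PairingData

end FusionData

/-! ### The numerical data of a unitary modular category. -/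

section Modular

variable {C : Type u} [Category.{v} C] [Abelian C] [Linear ℂ C] [MonoidalCategory C]
  [MonoidalPreadditive C] [MonoidalLinear ℂ C] [RightRigidCategory C] [IsFusion C]

theorem unitLabel_iso : Nonempty ((unitLabel C).obj ≅ 𝟙_ C) :=
  Label.mk_eq_mk.1 (Label.mk_obj (unitLabel C))

variable [BraidedCategory C] [Ribbon C] [Unitary C]

theorem qdim_ne_zero {X : C} (hX : Simple X) : qdim X ≠ 0 := fun h => by
  simpa [h] using (qdim_pos hX).1

theorem conj_qdim {X : C} (hX : Simple X) : conj (qdim X) = qdim X :=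
  Complex.conj_eq_iff_im.2 (qdim_pos hX).2

/-- The numerical data of a unitary modular category. -/
def pairingData (hC : IsModular C) : PairingData (Label C) where
  S := unnormalizedS C
  S' r j := hopf r.obj j.objᘁ
  d i := qdim i.obj
  N := fusionCoeff
  unit := unitLabel C
  conj_d i := conj_qdim i.simple_obj
  d_ne_zero i := qdim_ne_zero i.simple_obj
  symm i j := hopf_comm _ _
  unit_left i := by
    obtain ⟨e⟩ := unitLabel_iso (C := C)
    exact (hopf_congr_left e _).trans (hopf_unit_left _)
  isUnit_det := hC
  fusion r j k := by
    have h := hopf_tensor r.simple_obj j.obj k.obj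
    rw [hopf_eq_sum, mul_comm] at h
    exact h.symm
  fusion_dual r j k := by
    have h := hopf_tensor r.simple_obj j.objᘁ k.obj
    rw [hopf_eq_sum, mul_comm] at h
    simp_rw [finrank_tensor_label_symm] at h
    exact h.symm
  fusion_unit j k := by
    obtain ⟨e⟩ := unitLabel_iso (C := C)
    rw [fusionCoeff, ← finrank_hom_label]
    exact (Linear.homCongr ℂ (whiskerLeftIso j.obj e ≪≫ ρ_ j.obj) (Iso.refl _)).finrank_eq

end Modular

section Preadditive

variable {C : Type u} [Category.{v} C] [Preadditive C] [MonoidalCategory C] [MonoidalPreadditive C]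

theorem neg_whiskerRight {X Y : C} (g : X ⟶ Y) (Z : C) : (-g) ▷ Z = -(g ▷ Z) :=
  (tensorRight Z).map_neg

theorem whiskerLeft_neg (X : C) {Y Z : C} (g : Y ⟶ Z) : X ◁ (-g) = -(X ◁ g) :=
  (tensorLeft X).map_neg

end Preadditive

/-! ### Orbits of the fermion and its braiding with itself. -/

section Orbits

variable {C : Type u} [Category.{v} C] [Abelian C] [MonoidalCategory C] [BraidedCategory C]
  [RightRigidCategory C] [Ribbon C] {F : C}

theorem act_iso (hF : IsFermion F) (i : Label C) : Nonempty ((act hF i).obj ≅ F ⊗ i.obj) := by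
  have h : act hF i = Label.mk (F ⊗ i.obj) (hF.simple_tensor i.simple_obj) := by
    conv_lhs => rw [← i.mk_obj]
    rfl
  exact Label.mk_eq_mk.1 ((Label.mk_obj _).trans h)

theorem EvenOrbit.isEven_rep {hF : IsFermion F} (r : EvenOrbit hF) : IsEven F r.rep :=
  (Quotient.out r).2

theorem EvenOrbit.orbit_rep {hF : IsFermion F} (r : EvenOrbit hF) :
    EvenLabel.orbit hF ⟨r.rep, r.isEven_rep⟩ = r :=
  Quotient.out_eq r

theorem EvenLabel.orbit_eq_iff {hF : IsFermion F} {i j : EvenLabel F} :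
    i.orbit hF = j.orbit hF ↔ j.1 = i.1 ∨ j.1 = act hF i.1 :=
  Quotient.eq

theorem EvenLabel.rep_orbit (hF : IsFermion F) (i : EvenLabel F) :
    (i.orbit hF).rep = i.1 ∨ (i.orbit hF).rep = act hF i.1 :=
  EvenLabel.orbit_eq_iff.1 (i.orbit hF).orbit_rep.symm

theorem EvenOrbit.rep_eq_iff {hF : IsFermion F} (a b : EvenOrbit hF) : a.rep = b.rep ↔ a = b := by
  refine ⟨fun h => ?_, fun h => h ▸ rfl⟩
  rw [← a.orbit_rep, ← b.orbit_rep]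
  exact EvenLabel.orbit_eq_iff.2 (Or.inl h.symm)

variable [MonoidalPreadditive C]

/-- The twist of `F ⊗ F ≅ 𝟙` is trivial and `(-1)(-1) = 1`, so the twist axiom leaves only the
double braiding. -/
theorem IsFermion.monodromy_self (hF : IsFermion F) : monodromy F F = 𝟙 (F ⊗ F) := by
  obtain ⟨e⟩ := hF.tensor_self
  have h := Ribbon.twist_naturality e.hom
  rw [twist_unit, Category.comp_id, Ribbon.twist_tensor, hF.twist_eq] at h
  rw [← cancel_mono e.hom, Category.id_comp, monodromy]
  conv_rhs => rw [h]
  simp [MonoidalCategory.tensorHom_def, neg_whiskerRight, whiskerLeft_neg]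

end Orbits

/-! ### The sign character of the fermion and sums over even labels. -/

section Fermions

variable {C : Type u} [Category.{v} C] [Abelian C] [Linear ℂ C] [MonoidalCategory C]
  [MonoidalPreadditive C] [MonoidalLinear ℂ C] [BraidedCategory C] [RightRigidCategory C]
  [IsFusion C] [Ribbon C] {F : C}

theorem qdim_congr {X Y : C} (e : X ≅ Y) : qdim X = qdim Y := by
  rw [← hopf_unit_left, ← hopf_unit_left, hopf_congr_right _ e]

/-- A fermion acts freely on the even labels. -/
theorem act_ne_self (hF : IsFermion F) {i : Label C} (hi : IsEven F i) : act hF i ≠ i := by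
  intro h
  obtain ⟨e⟩ := act_iso hF i
  rw [h] at e
  have := i.simple_obj
  obtain ⟨t, ht⟩ := exists_smul_id i.simple_obj (Ribbon.twist i.obj).hom
  have hβ : (β_ F i.obj).hom ≫ (β_ i.obj F).hom = 𝟙 _ := by
    rw [← cancel_epi (β_ i.obj F).hom, reassoc_of% hi, Category.comp_id]
  -- If `fi = i`, the twist `t` of `X_i` equals that of `F ⊗ X_i`, which is `-t` because the double
  -- braiding is trivial.
  have hn := Ribbon.twist_naturality e.hom
  rw [Ribbon.twist_tensor, hβ, Category.comp_id, hF.twist_eq, ht] at hn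
  have h0 : (2 * t) • e.hom = 0 := by
    have : -(t • e.hom) = t • e.hom := by
      simpa [MonoidalCategory.tensorHom_def, neg_whiskerRight] using hn
    rw [mul_smul, two_smul]
    nth_rw 1 [← this]
    simp
  have he : e.hom ≠ 0 := fun h0 => id_nonzero i.obj (by rw [← e.hom_inv_id, h0, zero_comp])
  have ht0 : t = 0 := by simpa [he] using h0
  rw [ht0, zero_smul] at ht
  exact id_nonzero i.obj (by rw [← (Ribbon.twist i.obj).hom_inv_id, ht, zero_comp])

theorem EvenOrbit.act_rep_ne {hF : IsFermion F} (a b : EvenOrbit hF) : act hF a.rep ≠ b.rep := by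
  intro h
  have hab : a = b := by
    rw [← a.orbit_rep, ← b.orbit_rep]
    exact EvenLabel.orbit_eq_iff.2 (Or.inr h.symm)
  exact act_ne_self hF a.isEven_rep (h.trans (congrArg EvenOrbit.rep hab.symm))

variable (F) in
/-- The sign by which a fermion braids with a simple object. -/
def charge (i : Label C) : ℂ := hopf i.obj F / qdim i.obj

variable [Unitary C]

/-- The squares agree because `F ⊗ F ≅ 𝟙`; positivity selects the sign. -/
theorem IsFermion.qdim_eq (hF : IsFermion F) : qdim F = qdim (𝟙_ C) := by
  obtain ⟨e⟩ := hF.tensor_self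
  have h := hopf_tensor (IsFusion.simple_unit (C := C)) F F
  rw [hopf_unit_left, hopf_unit_left, qdim_congr e] at h
  obtain ⟨h₁, h₂⟩ := qdim_pos hF.simple
  obtain ⟨h₃, h₄⟩ := qdim_pos (IsFusion.simple_unit (C := C))
  rcases mul_self_eq_mul_self_iff.1 h.symm with h | h
  · exact h
  · have := congrArg Complex.re h
    rw [Complex.neg_re] at this
    linarith

theorem IsFermion.qdim_tensor (hF : IsFermion F) (X : C) : qdim (F ⊗ X) = qdim X := by
  have h := hopf_tensor (IsFusion.simple_unit (C := C)) F X
  rw [hopf_unit_left, hopf_unit_left, hopf_unit_left, hF.qdim_eq, mul_comm] at h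
  exact mul_left_cancel₀ (qdim_ne_zero IsFusion.simple_unit) h

theorem qdim_act (hF : IsFermion F) (i : Label C) : qdim (act hF i).obj = qdim i.obj := by
  obtain ⟨e⟩ := act_iso hF i
  rw [qdim_congr e, hF.qdim_tensor]

theorem unnormalizedS_act_right (hF : IsFermion F) (i j : Label C) :
    unnormalizedS C i (act hF j) = charge F i * unnormalizedS C i j := by
  obtain ⟨e⟩ := act_iso hF j
  have h := hopf_tensor i.simple_obj F j.obj
  have h' : unnormalizedS C i (act hF j) = hopf i.obj (F ⊗ j.obj) := hopf_congr_right _ e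
  have hd := qdim_ne_zero i.simple_obj
  rw [h', charge, div_mul_eq_mul_div, eq_div_iff hd, h]
  rfl

theorem charge_sq (hF : IsFermion F) (i : Label C) : charge F i * charge F i = 1 := by
  obtain ⟨e⟩ := hF.tensor_self
  have hd := qdim_ne_zero i.simple_obj
  rw [charge, div_mul_div_comm, ← hopf_tensor i.simple_obj, hopf_congr_right _ e, hopf_comm,
    hopf_unit_left, div_self (mul_ne_zero hd hd)]

/-- `X_i ⊗ F` is simple, so the double braiding is a scalar; its trace identifies that scalar with
the charge, as `F` does not change dimensions. -/
theorem isEven_iff_charge (hF : IsFermion F) (i : Label C) : IsEven F i ↔ charge F i = 1 := by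
  have hd := qdim_ne_zero i.simple_obj
  have : Simple (F ⊗ i.obj) := hF.simple_tensor i.simple_obj
  have hs : Simple (i.obj ⊗ F) := Simple.of_iso (β_ i.obj F)
  obtain ⟨c, hc⟩ := exists_smul_id hs (monodromy i.obj F)
  have h : charge F i = c := by
    rw [charge, div_eq_iff hd, hopf, hc, qtrace_smul, ← hF.qdim_tensor, ← qdim_congr (β_ i.obj F),
      qdim]
  change monodromy i.obj F = 𝟙 _ ↔ _
  rw [h, hc]
  refine ⟨fun h' => smul_left_injective ℂ (id_nonzero (i.obj ⊗ F)) ?_, fun h' => ?_⟩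
  · simpa using h'
  · rw [h', one_smul]

/-- The charge is multiplicative and `F` braids trivially with itself. -/
theorem charge_act (hF : IsFermion F) (i : Label C) : charge F (act hF i) = charge F i := by
  obtain ⟨e⟩ := act_iso hF i
  have h := hopf_tensor hF.simple F i.obj
  have h' : hopf F F = qdim F := by
    obtain ⟨e⟩ := hF.tensor_self
    rw [hopf, hF.monodromy_self, hF.qdim_eq, ← qdim_congr e, qdim]
  rw [h', mul_comm] at h
  rw [charge, charge, qdim_act, hopf_comm, hopf_congr_right _ e,
    mul_left_cancel₀ (qdim_ne_zero hF.simple) h, hopf_comm]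

theorem isEven_act (hF : IsFermion F) {i : Label C} (hi : IsEven F i) : IsEven F (act hF i) := by
  rwa [isEven_iff_charge hF, charge_act, ← isEven_iff_charge hF]

theorem charge_of_not_isEven (hF : IsFermion F) {i : Label C} (hi : ¬ IsEven F i) :
    charge F i = -1 :=
  (mul_self_eq_one_iff.1 (charge_sq hF i)).resolve_left fun h => hi ((isEven_iff_charge hF i).2 h)

theorem unnormalizedS_act_left (hF : IsFermion F) (i j : Label C) :
    unnormalizedS C (act hF i) j = charge F j * unnormalizedS C i j := by
  have h (i j : Label C) : unnormalizedS C i j = unnormalizedS C j i := hopf_comm _ _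
  rw [h, unnormalizedS_act_right, h]

-- Twice the indicator of the even labels is `1 + charge`.
open scoped Classical in
theorem sum_even (hF : IsFermion F) (g : Label C → ℂ) :
    2 * ∑ i with IsEven F i, g i = ∑ i, g i + ∑ i, charge F i * g i := by
  rw [Finset.sum_filter, Finset.mul_sum, ← Finset.sum_add_distrib]
  refine Finset.sum_congr rfl fun i _ => ?_
  split_ifs with hi
  · rw [(isEven_iff_charge hF i).1 hi]; ring
  · rw [charge_of_not_isEven hF hi]; ring

open scoped Classical in
theorem sum_even_eq_sum_orbit (hF : IsFermion F) (g : Label C → ℂ)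
    (hg : ∀ i, IsEven F i → g (act hF i) = g i) :
    ∑ i with IsEven F i, g i = 2 * ∑ r : EvenOrbit hF, g r.rep := by
  have h (r : EvenOrbit hF) : 2 * g r.rep = ∑ i ∈ {r.rep, act hF r.rep}, g i := by
    rw [Finset.sum_pair (act_ne_self hF r.isEven_rep).symm, hg _ r.isEven_rep, two_mul]
  rw [Finset.mul_sum, Finset.sum_congr rfl fun r _ => h r, ← Finset.sum_biUnion]
  · refine Finset.sum_congr (Finset.ext fun i => ?_) fun _ _ => rfl
    simp only [Finset.mem_filter, Finset.mem_univ, true_and, Finset.mem_biUnion,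
      Finset.mem_insert, Finset.mem_singleton]
    refine ⟨fun hi => ⟨EvenLabel.orbit hF ⟨i, hi⟩, ?_⟩, ?_⟩
    · exact EvenLabel.orbit_eq_iff.1 (EvenOrbit.orbit_rep (EvenLabel.orbit hF ⟨i, hi⟩))
    · rintro ⟨r, rfl | rfl⟩
      · exact r.isEven_rep
      · exact isEven_act hF r.isEven_rep
  · intro r _ t _ hrt
    rw [Function.onFun, Finset.disjoint_left]
    intro i hi hi'
    refine hrt ?_
    simp only [Finset.mem_insert, Finset.mem_singleton] at hi hi'
    have he : IsEven F i := by
      rcases hi with rfl | rfl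
      · exact r.isEven_rep
      · exact isEven_act hF r.isEven_rep
    rw [← r.orbit_rep, ← t.orbit_rep]
    exact (EvenLabel.orbit_eq_iff (j := ⟨i, he⟩).2 hi).trans
      (EvenLabel.orbit_eq_iff (j := ⟨i, he⟩).2 hi').symm

end Fermions

/-! ### Unitarity and the Verlinde formula on orbits. -/

section Main

variable {C : Type u} [Category.{v} C] [Abelian C] [Linear ℂ C] [MonoidalCategory C]
  [MonoidalPreadditive C] [MonoidalLinear ℂ C] [BraidedCategory C] [RightRigidCategory C]
  [IsFusion C] [Ribbon C] [Unitary C] {F : C}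

theorem conj_charge (hF : IsFermion F) (i : Label C) : conj (charge F i) = charge F i := by
  rcases mul_self_eq_one_iff.1 (charge_sq hF i) with h | h <;> simp [h]

variable (C) in
theorem totalDim_mul_self : (totalDim C : ℂ) * totalDim C = ∑ i : Label C, qdim i.obj ^ 2 := by
  have h (i : Label C) : qdim i.obj ^ 2 = (((qdim i.obj).re ^ 2 : ℝ) : ℂ) := by
    rw [Complex.ofReal_pow, Complex.conj_eq_iff_re.1 (conj_qdim i.simple_obj)]
  simp_rw [totalDim, h]
  rw [← Complex.ofReal_sum, Complex.ofReal_re, ← Complex.ofReal_mul,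
    Real.mul_self_sqrt (Finset.sum_nonneg fun i _ => sq_nonneg _)]

theorem totalDim_ne_zero (hC : IsModular C) : (totalDim C : ℂ) ≠ 0 := fun h =>
  (pairingData hC).globalDim_ne_zero ((totalDim_mul_self C).symm.trans (by rw [h, zero_mul]))

-- The charge in the second half of `sum_even` is absorbed by replacing `j` with `fj`, so full
-- orthogonality applies twice.
open scoped Classical in
theorem sum_even_orthogonality (hC : IsModular C) (hF : IsFermion F) (j k : Label C) :
    2 * ∑ r with IsEven F r, unnormalizedS C j r * conj (unnormalizedS C k r) =
      (if j = k then 1 else 0) * (totalDim C : ℂ) * totalDim C +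
        (if act hF j = k then 1 else 0) * totalDim C * totalDim C := by
  have h₁ := (pairingData hC).orthogonality j k
  have h₂ := (pairingData hC).orthogonality (act hF j) k
  simp only [pairingData, PairingData.globalDim, unnormalizedS_act_left] at h₁ h₂
  rw [sum_even hF, h₁]
  simp_rw [← mul_assoc (charge F _)]
  rw [h₂, mul_assoc, mul_assoc, totalDim_mul_self]
  simp

-- The same projection applied to the Verlinde formula; here the charge is absorbed into `k`.
open scoped Classical in
theorem fusionCoeff_add_act (hC : IsModular C) (hF : IsFermion F) (i j k : Label C) :
    ((fusionCoeff i j k + fusionCoeff i j (act hF k) : ℕ) : ℂ) * (totalDim C * totalDim C) =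
      2 * ∑ r with IsEven F r, unnormalizedS C i r * unnormalizedS C j r *
        conj (unnormalizedS C k r) / qdim r.obj := by
  have h₁ := (pairingData hC).verlinde i j k
  have h₂ := (pairingData hC).verlinde i j (act hF k)
  simp only [pairingData, PairingData.globalDim, unnormalizedS_act_left, map_mul,
    conj_charge hF] at h₁ h₂
  rw [sum_even hF, h₁, Nat.cast_add, add_mul, totalDim_mul_self, ← h₂]
  congr 1
  refine Finset.sum_congr rfl fun r _ => ?_
  ring

theorem unnormalizedS_congr (hF : IsFermion F) {i i' r : Label C} (hr : IsEven F r)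
    (h : i' = i ∨ i' = act hF i) : unnormalizedS C i' r = unnormalizedS C i r := by
  rcases h with rfl | rfl
  · rfl
  · rw [unnormalizedS_act_left, (isEven_iff_charge hF r).1 hr, one_mul]

theorem quotientS_orbit (hF : IsFermion F) (i j : EvenLabel F) :
    quotientS hF (i.orbit hF) (j.orbit hF) = 2 * normalizedS C i.1 j.1 := by
  have h : unnormalizedS C (i.orbit hF).rep (j.orbit hF).rep = unnormalizedS C i.1 j.1 := by
    have hs (i j : Label C) : unnormalizedS C i j = unnormalizedS C j i := hopf_comm _ _
    rw [unnormalizedS_congr hF (j.orbit hF).isEven_rep (i.rep_orbit hF), hs,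
      unnormalizedS_congr hF i.2 (j.rep_orbit hF), hs]
  rw [quotientS, normalizedS, normalizedS, h]

/-- Read off from `fusionCoeff_add_act`: its right-hand side involves only columns at even labels,
which are constant along orbits. -/
theorem naiveFusion_orbit (hC : IsModular C) (hF : IsFermion F) (i j k : EvenLabel F) :
    naiveFusion hF (i.orbit hF) (j.orbit hF) (k.orbit hF) =
      fusionCoeff i.1 j.1 k.1 + fusionCoeff i.1 j.1 (act hF k.1) := by
  classical
  have hD := totalDim_ne_zero hC
  refine Nat.cast_injective (R := ℂ) (mul_right_cancel₀ (mul_ne_zero hD hD) ?_)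
  rw [naiveFusion, fusionCoeff_add_act hC, fusionCoeff_add_act hC]
  congr 1
  refine Finset.sum_congr rfl fun r hr => ?_
  have hr' := (Finset.mem_filter.1 hr).2
  rw [unnormalizedS_congr hF hr' (i.rep_orbit hF), unnormalizedS_congr hF hr' (j.rep_orbit hF),
    unnormalizedS_congr hF hr' (k.rep_orbit hF)]

theorem unnormalizedS_act_right_of_isEven (hF : IsFermion F) {i : Label C} (hi : IsEven F i)
    (r : Label C) : unnormalizedS C i (act hF r) = unnormalizedS C i r := by
  rw [unnormalizedS_act_right, (isEven_iff_charge hF i).1 hi, one_mul]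

theorem quotientS_mem_unitaryGroup (hC : IsModular C) (hF : IsFermion F) :
    quotientS hF ∈ Matrix.unitaryGroup (EvenOrbit hF) ℂ := by
  classical
  have hD := totalDim_ne_zero hC
  rw [Matrix.mem_unitaryGroup_iff]
  ext a b
  have h := sum_even_orthogonality hC hF a.rep b.rep
  rw [sum_even_eq_sum_orbit hF _ fun r _ => by
    rw [unnormalizedS_act_right_of_isEven hF a.isEven_rep,
      unnormalizedS_act_right_of_isEven hF b.isEven_rep]] at h
  -- The term at `fj = k` drops out: the translate of a representative is never a representative.
  simp only [EvenOrbit.rep_eq_iff, EvenOrbit.act_rep_ne, if_false, zero_mul, add_zero] at h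
  calc
    _ = ∑ r : EvenOrbit hF, 2 * 2 / (totalDim C * totalDim C) *
        (unnormalizedS C a.rep r.rep * conj (unnormalizedS C b.rep r.rep)) := by
      refine Finset.sum_congr rfl fun r _ => ?_
      simp only [Matrix.star_apply, quotientS, normalizedS, RCLike.star_def, map_mul, map_div₀,
        Complex.conj_ofReal, map_ofNat]
      field_simp
    _ = if a = b then 1 else 0 := by
      rw [← Finset.mul_sum, div_mul_eq_mul_div, mul_assoc, h, mul_assoc,
        mul_div_cancel_right₀ _ (mul_ne_zero hD hD)]
    _ = _ := by rw [Matrix.one_apply]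

theorem quotientS_evenUnit (hF : IsFermion F) (hC : IsModular C) (r : EvenOrbit hF) :
    quotientS hF ((evenUnit F).orbit hF) r = 2 * (qdim r.rep.obj / totalDim C) := by
  have h := quotientS_orbit hF (evenUnit F) ⟨r.rep, r.isEven_rep⟩
  rw [r.orbit_rep] at h
  exact h.trans (congrArg (fun x => 2 * (x / (totalDim C : ℂ)))
    ((pairingData hC).unit_left r.rep))

theorem quotientS_evenUnit_ne_zero (hC : IsModular C) (hF : IsFermion F) (r : EvenOrbit hF) :
    quotientS hF ((evenUnit F).orbit hF) r ≠ 0 := by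
  rw [quotientS_evenUnit hF hC]
  exact mul_ne_zero two_ne_zero
    (div_ne_zero (qdim_ne_zero r.rep.simple_obj) (totalDim_ne_zero hC))

theorem naiveFusion_eq_sum (hC : IsModular C) (hF : IsFermion F) (a b c : EvenOrbit hF) :
    (naiveFusion hF a b c : ℂ) =
      ∑ r : EvenOrbit hF, quotientS hF a r * quotientS hF b r * conj (quotientS hF c r) /
        quotientS hF ((evenUnit F).orbit hF) r := by
  classical
  have hD := totalDim_ne_zero hC
  have h := fusionCoeff_add_act hC hF a.rep b.rep c.rep
  -- Evenness of the three labels makes the summand constant on orbits. The resulting factor `4`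
  -- matches `2 ^ 3 / 2` from the normalization of `[s]`.
  rw [sum_even_eq_sum_orbit hF _ fun r _ => by
    rw [unnormalizedS_act_right_of_isEven hF a.isEven_rep,
      unnormalizedS_act_right_of_isEven hF b.isEven_rep,
      unnormalizedS_act_right_of_isEven hF c.isEven_rep, qdim_act]] at h
  rw [naiveFusion, eq_div_of_mul_eq (mul_ne_zero hD hD) h, Finset.mul_sum, Finset.mul_sum,
    Finset.sum_div]
  refine Finset.sum_congr rfl fun r _ => ?_
  have hr := qdim_ne_zero r.rep.simple_obj
  rw [quotientS_evenUnit hF hC]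
  simp only [quotientS, normalizedS, map_mul, map_div₀, Complex.conj_ofReal, map_ofNat]
  field_simp

end Main

end

end SpinModular

theorem mainTheorem8 {C : Type u} [Category.{v} C] [Abelian C] [Linear ℂ C]
    [MonoidalCategory C] [MonoidalPreadditive C] [MonoidalLinear ℂ C] [BraidedCategory C]
    [RightRigidCategory C] [SpinModular.IsFusion C] [SpinModular.Ribbon C]
    [SpinModular.Unitary C] (hC : SpinModular.IsModular C)
    (F : C) (hF : SpinModular.IsFermion F) :
    -- `[s]` and the naive fusion rules do not depend on the choice of covering labels
    (∀ i j : SpinModular.EvenLabel F,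
      SpinModular.quotientS hF (i.orbit hF) (j.orbit hF) =
        2 * SpinModular.normalizedS C i.1 j.1) ∧
    (∀ i j k : SpinModular.EvenLabel F,
      SpinModular.naiveFusion hF (i.orbit hF) (j.orbit hF) (k.orbit hF) =
        SpinModular.fusionCoeff i.1 j.1 k.1 +
          SpinModular.fusionCoeff i.1 j.1 (SpinModular.act hF k.1)) ∧
    -- `[s]` is unitary
    SpinModular.quotientS hF ∈ Matrix.unitaryGroup (SpinModular.EvenOrbit hF) ℂ ∧
    -- the Verlinde formula, whose denominators do not vanish
    (∀ r : SpinModular.EvenOrbit hF,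
      SpinModular.quotientS hF ((SpinModular.evenUnit F).orbit hF) r ≠ 0) ∧
    (∀ a b c : SpinModular.EvenOrbit hF,
      (SpinModular.naiveFusion hF a b c : ℂ) =
        ∑ r : SpinModular.EvenOrbit hF,
          SpinModular.quotientS hF a r * SpinModular.quotientS hF b r *
            (starRingEnd ℂ) (SpinModular.quotientS hF c r) /
          SpinModular.quotientS hF ((SpinModular.evenUnit F).orbit hF) r) :=
  ⟨SpinModular.quotientS_orbit hF, SpinModular.naiveFusion_orbit hC hF,
    SpinModular.quotientS_mem_unitaryGroup hC hF, SpinModular.quotientS_evenUnit_ne_zero hC hF,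
    SpinModular.naiveFusion_eq_sum hC hF⟩
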